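/- **Lower bound on communication rounds.** Work in $\ell_2$. For functions $f_1,\dots,f_n:\ell_2\to\mathbb R$ held by $n$ nodes, put $f=\frac1n\sum_{i=1}^n f_i$. A gossip matrix of a graph $\mathcal G$ on $\{1,\dots,n\}$ is a matrix $W\in\mathbb R^{n\times n}$ with $W_{ij}=0$ whenever $i\ne j$ and $(i,j)$ is not an edge, and with $\ker W=\{x: x_1=\dots=x_n\}$; for symmetric positive semidefinite $W$ let $\chi(W)=\lambda_{\max}(W)/\lambda_{\min}^+(W)$, where $\lambda_{\min}^+$ is the smallest positive eigenvalue. A *first-order decentralized method* $\mathcal M$ starts from a point $x_0\in\ell_2$ chosen independently of the problem. Run on functions $(f_i)$ and a time-varying network $(\mathcal G_k,W_k)_{k\ge0}$, it makes every time step $k\ge 0$ either a local computation or a communication round (a decision that may depend on the functions and on the network up to time $k$, but not on the future of the network), and the local memories $\mathcal H_i(k)\subseteq\ell_2$ satisfy $\mathcal H_i(0)=\{x_0\}$ and $$\mathcal H_i(k+1)\subseteq\operatorname{span}\{x,\nabla f_i(x),\nabla f_i^*(x):x\in\mathcal H_i(k)\}$$ if step $k$ is a local computation ($f_i^*$ being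 the Fenchel dual), and $$\mathcal H_i(k+1)\subseteq\operatorname{span}\Big(\mathcal H_i(k)\cup\bigcup_{j:\,(i,j)\text{ is an edge of }\mathcal G_k}\mathcal H_j(k)\Big)$$ if step $k$ is a communication round. There are absolute constants $c>0$ and $\varepsilon_0\in(0,1)$ such that for all $\chi\ge56$, all $L>16\mu>0$ and every first-order decentralized method $\mathcal M$ there exist $n$, $L$-smooth and $\mu$-strongly convex functions $f_1,\dots,f_n:\ell_2\to\mathbb R$, graphs $\mathcal G_k$ on $n$ nodes and symmetric positive semidefinite gossip matrices $W_k$ of $\mathcal G_k$ ($k=0,1,\dots$) such that $\chi(W_k)=\chi$ for all $k$, the edge sets of $\mathcal G_k$ and $\mathcal G_{k+1}$ differ in at most two edges for all $k$, $f$ has a minimizer $x_*$, and for every $\varepsilon\in(0,\varepsilon_0]$: if at some time step $k$ some node's memory contains a vector $x$ with $\|x-x_*\|^2\le\varepsilon\|x_0-x_*\|^2$, then $\mathcal M$ has performed at least $$c\,\chi\sqrt{L/\mu}\,\log(1/\varepsilon)$$ communication rounds before time step $k$. -/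

import Mathlib

namespace Decentralized

/-- The Hilbert space `ℓ₂` of square-summable real sequences, on which the local functions live. -/
abbrev Ell2 : Type := lp (fun _ : ℕ => ℝ) 2

/-- `L`-smoothness: `f` is differentiable and its gradient is `L`-Lipschitz. -/
def IsSmooth (L : ℝ) (f : Ell2 → ℝ) : Prop :=
  Differentiable ℝ f ∧ ∀ x y : Ell2, ‖gradient f y - gradient f x‖ ≤ L * ‖y - x‖

/-- `μ`-strong convexity of a differentiable function. -/
def IsStronglyConvex (μ : ℝ) (f : Ell2 → ℝ) : Prop :=
  Differentiable ℝ f ∧ ∀ x y : Ell2,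
    f x + inner ℝ (gradient f x) (y - x) + μ / 2 * ‖y - x‖ ^ 2 ≤ f y

/-- The Fenchel dual `f*(y) = sup_x (⟨y, x⟩ - f x)`. For the strongly convex functions considered
below the supremum is finite. -/
noncomputable def fenchelDual (f : Ell2 → ℝ) (y : Ell2) : ℝ :=
  ⨆ x : Ell2, (inner ℝ y x - f x)

/-- The global function `f = (1/n) ∑ᵢ fᵢ`. -/
noncomputable def globalFunction {n : ℕ} (f : Fin n → Ell2 → ℝ) (x : Ell2) : ℝ :=
  (1 / (n : ℝ)) * ∑ i, f i x

/-- `W` is a gossip matrix of the graph `G`: it vanishes off the diagonal outside the edges, and its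
kernel consists exactly of the constant vectors. -/
def IsGossipMatrix {n : ℕ} (G : SimpleGraph (Fin n)) (W : Matrix (Fin n) (Fin n) ℝ) : Prop :=
  (∀ i j, i ≠ j → ¬ G.Adj i j → W i j = 0) ∧
  (∀ x : Fin n → ℝ, W.mulVec x = 0 ↔ ∀ i j, x i = x j)

/-- The condition number `χ(W) = λ_max(W) / λ_min⁺(W)`: largest eigenvalue over smallest positive
eigenvalue. If there is no positive eigenvalue the value is `0`. -/
noncomputable def conditionNumber {n : ℕ} (W : Matrix (Fin n) (Fin n) ℝ) : ℝ :=
  sSup (spectrum ℝ W) / sInf {l : ℝ | l ∈ spectrum ℝ W ∧ 0 < l}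

/-- The data of a time-varying network on `n` nodes: at each time step a graph and a matrix. -/
structure Network (n : ℕ) where
  graph : ℕ → SimpleGraph (Fin n)
  gossip : ℕ → Matrix (Fin n) (Fin n) ℝ

/-- A first-order decentralized method. Given local functions `f` and a time-varying network `N`, it
decides at each time step `k` whether the step is a communication round (`isComm f N k`) or a local
computation, and it produces the local memories `memory f N k i`, subject to the span conditions.
It starts from a common point chosen before the instance is known. The kind of step `k` may depend
on the functions and on the network up to time `k`, but not on the future of the network. -/
structure FirstOrderMethod where
  start : Ell2
  isComm : {n : ℕ} → (Fin n → Ell2 → ℝ) → Network n → ℕ → Prop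
  memory : {n : ℕ} → (Fin n → Ell2 → ℝ) → Network n → ℕ → Fin n → Set Ell2
  nonanticipating : ∀ {n : ℕ} (f : Fin n → Ell2 → ℝ) (N N' : Network n) (k : ℕ),
    (∀ j ≤ k, N.graph j = N'.graph j ∧ N.gossip j = N'.gossip j) →
      (isComm f N k ↔ isComm f N' k)
  memory_zero : ∀ {n : ℕ} (f : Fin n → Ell2 → ℝ) (N : Network n) (i : Fin n),
    memory f N 0 i = {start}
  memory_local : ∀ {n : ℕ} (f : Fin n → Ell2 → ℝ) (N : Network n) (k : ℕ),
    ¬ isComm f N k → ∀ i : Fin n,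
      memory f N (k + 1) i ⊆
        (Submodule.span ℝ {z : Ell2 | ∃ x ∈ memory f N k i,
          z = x ∨ z = gradient (f i) x ∨ z = gradient (fenchelDual (f i)) x} : Set Ell2)
  memory_comm : ∀ {n : ℕ} (f : Fin n → Ell2 → ℝ) (N : Network n) (k : ℕ),
    isComm f N k → ∀ i : Fin n,
      memory f N (k + 1) i ⊆
        (Submodule.span ℝ {z : Ell2 | ∃ j : Fin n,
          (j = i ∨ (N.graph k).Adj i j) ∧ z ∈ memory f N k j} : Set Ell2)

open Classical in
/-- The number of communication rounds performed by the method before time step `k`. -/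
noncomputable def FirstOrderMethod.commRounds (M : FirstOrderMethod) {n : ℕ}
    (f : Fin n → Ell2 → ℝ) (N : Network n) (k : ℕ) : ℕ :=
  Nat.count (fun j => M.isComm f N j) k

end Decentralized

/-!
In a suitable orthonormal basis the starting point lies on the coordinate axis `0`. There are three
kinds of local functions, all quadratic. Their mean is a chain along the other coordinates, whose
minimizer is the starting point plus a geometric sequence of ratio `q = 1 - O(√(μ/L))`, so a vector
vanishing beyond coordinate `m` has relative squared error at least `q ^ (2m)`. But `left` functions
only couple `2 ↔ 3`, `4 ↔ 5`, ..., `right` functions couple `1 ↔ 2`, `3 ↔ 4`, ..., and `middle`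
functions nothing. So a `left` node by itself can only pass from an even level to the next odd one,
a `right` node only from odd to even. This also holds for the gradients of the Fenchel duals: a
function that is invariant under the reflection in a closed subspace has its dual invariant too, and
the gradient of either maps the subspace into itself.

The network consists of a `left` and a `right` star, linked through a single `middle` node; the
other `middle` nodes are leaves of either star. In each communication round the next `middle` node
becomes the link, and the previous one is moved into the star from which it could have received the
new coordinate. Hence a coordinate crosses only after all `k + 3` `middle` nodes have been the link,
where `k` is proportional to `χ`; then the direction is reversed.

The edges are weighted so that the tree has a spectrum of the right order. An additional edge
between twin leaves changes only the eigenvalue of the difference of the twins. One such edge, of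
negative weight, lowers an eigenvalue to the least positive one, `1 / 2`, and another raises an
eigenvalue to the largest one, `χ / 2`, which makes the condition number equal to `χ`.
-/

namespace Decentralized

section Quadratic

variable {E : Type*} [NormedAddCommGroup E] [InnerProductSpace ℝ E]

/-- The quadratic function with Hessian `A` and linear term `h`. -/
noncomputable def quadratic (A : E →L[ℝ] E) (h x : E) : ℝ :=
  1 / 2 * inner ℝ (A x) x - inner ℝ h x

lemma quadratic_add {A : E →L[ℝ] E} (hA : (A : E →ₗ[ℝ] E).IsSymmetric) (h x d : E) :
    quadratic A h (x + d) = quadratic A h x + inner ℝ (A x - h) d + 1 / 2 * inner ℝ (A d) d := by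
  have hdx : inner ℝ (A d) x = inner ℝ (A x) d := by rw [real_inner_comm]; exact (hA x d).symm
  simp only [quadratic, map_add, inner_add_left, inner_add_right, inner_sub_left, hdx]
  ring

lemma quadratic_reflection {A : E →L[ℝ] E} (hA : (A : E →ₗ[ℝ] E).IsSymmetric) {h : E}
    {K : Submodule ℝ E} [K.HasOrthogonalProjection] (hAK : ∀ x ∈ K, A x ∈ K) (hh : h ∈ K) (x : E) :
    quadratic A h (K.reflection x) = quadratic A h x := by
  obtain ⟨u, hu, v, hv, rfl⟩ := K.exists_add_mem_mem_orthogonal x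
  have hgrad : inner ℝ (A u - h) v = 0 := hv _ (K.sub_mem (hAK u hu) hh)
  rw [map_add, K.reflection_mem_subspace_eq_self hu,
    K.reflection_mem_subspace_orthogonalComplement_eq_neg hv, quadratic_add hA, quadratic_add hA]
  simp only [hgrad, map_neg, inner_neg_left, inner_neg_right, neg_neg, neg_zero]

variable [CompleteSpace E]

lemma hasGradientAt_quadratic {A : E →L[ℝ] E} (hA : (A : E →ₗ[ℝ] E).IsSymmetric) (h x : E) :
    HasGradientAt (quadratic A h) (A x - h) x := by
  rw [hasGradientAt_iff_hasFDerivAt]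
  have hform : HasFDerivAt (fun y => inner ℝ (A y) y) (2 • innerSL ℝ (A x)) x :=
    (hA.hasStrictFDerivAt_reApplyInnerSelf x).hasFDerivAt
  refine ((hform.const_mul (1 / 2)).sub (innerSL ℝ h).hasFDerivAt).congr_fderiv ?_
  ext y
  simp

lemma gradient_quadratic {A : E →L[ℝ] E} (hA : (A : E →ₗ[ℝ] E).IsSymmetric) (h x : E) :
    gradient (quadratic A h) x = A x - h :=
  (hasGradientAt_quadratic hA h x).gradient

lemma gradient_map_of_invariant {f : E → ℝ} (R : E ≃ₗᵢ[ℝ] E) (hf : ∀ x, f (R x) = f x) (x : E) :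
    gradient f (R x) = R (gradient f x) := by
  have hcomp : fderiv ℝ f x = (fderiv ℝ f (R x)).comp (R.toContinuousLinearEquiv : E →L[ℝ] E) := by
    have := R.toContinuousLinearEquiv.comp_right_fderiv (f := f) (x := x)
    rwa [show f ∘ R.toContinuousLinearEquiv = f from funext hf] at this
  refine ext_inner_right ℝ fun y => ?_
  rw [← R.apply_symm_apply y, R.inner_map_map, inner_gradient_left, inner_gradient_left, hcomp]
  rfl

lemma gradient_mem_of_reflection_invariant {K : Submodule ℝ E} [K.HasOrthogonalProjection]
    {f : E → ℝ} (hf : ∀ x, f (K.reflection x) = f x) {x : E} (hx : x ∈ K) : gradient f x ∈ K := by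
  rw [← K.reflection_eq_self_iff, ← gradient_map_of_invariant _ hf,
    K.reflection_mem_subspace_eq_self hx]

end Quadratic

lemma isSmooth_quadratic {L : ℝ} {A : Ell2 →L[ℝ] Ell2} (hA : (A : Ell2 →ₗ[ℝ] Ell2).IsSymmetric)
    (h : Ell2) (hL : ∀ x, ‖A x‖ ≤ L * ‖x‖) : IsSmooth L (quadratic A h) := by
  refine ⟨fun x => (hasGradientAt_quadratic hA h x).differentiableAt, fun x y => ?_⟩
  rw [gradient_quadratic hA, gradient_quadratic hA, sub_sub_sub_cancel_right, ← map_sub]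
  exact hL _

lemma isStronglyConvex_quadratic {μ : ℝ} {A : Ell2 →L[ℝ] Ell2}
    (hA : (A : Ell2 →ₗ[ℝ] Ell2).IsSymmetric) (h : Ell2)
    (hμ : ∀ x, μ * ‖x‖ ^ 2 ≤ inner ℝ (A x) x) : IsStronglyConvex μ (quadratic A h) := by
  refine ⟨fun x => (hasGradientAt_quadratic hA h x).differentiableAt, fun x y => ?_⟩
  have hexp := quadratic_add hA h x (y - x)
  rw [add_sub_cancel] at hexp
  rw [gradient_quadratic hA, hexp]
  linarith [hμ (y - x)]

lemma fenchelDual_map_of_invariant {f : Ell2 → ℝ} (R : Ell2 ≃ₗᵢ[ℝ] Ell2) (hf : ∀ x, f (R x) = f x)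
    (y : Ell2) : fenchelDual f (R y) = fenchelDual f y :=
  (R.surjective.iSup_comp _).symm.trans <| iSup_congr fun x => by rw [R.inner_map_map, hf]

lemma gradient_quadratic_mem {A : Ell2 →L[ℝ] Ell2} (hA : (A : Ell2 →ₗ[ℝ] Ell2).IsSymmetric)
    {h : Ell2} {K : Submodule ℝ Ell2} (hAK : ∀ x ∈ K, A x ∈ K)
    (hh : h ∈ K) {x : Ell2} (hx : x ∈ K) : gradient (quadratic A h) x ∈ K := by
  rw [gradient_quadratic hA]
  exact K.sub_mem (hAK x hx) hh

lemma gradient_fenchelDual_quadratic_mem {A : Ell2 →L[ℝ] Ell2}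
    (hA : (A : Ell2 →ₗ[ℝ] Ell2).IsSymmetric) {h : Ell2} {K : Submodule ℝ Ell2}
    [K.HasOrthogonalProjection] (hAK : ∀ x ∈ K, A x ∈ K) (hh : h ∈ K) {x : Ell2} (hx : x ∈ K) :
    gradient (fenchelDual (quadratic A h)) x ∈ K :=
  gradient_mem_of_reflection_invariant
    (fenchelDual_map_of_invariant _ (quadratic_reflection hA hAK hh)) hx

lemma globalFunction_le_of_sum_gradient_eq_zero {n : ℕ} {μ : ℝ} (hμ : 0 ≤ μ)
    {f : Fin n → Ell2 → ℝ} (hf : ∀ i, IsStronglyConvex μ (f i)) {x : Ell2}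
    (hx : ∑ i, gradient (f i) x = 0) (y : Ell2) : globalFunction f x ≤ globalFunction f y := by
  have htangent : ∑ i, (f i x + inner ℝ (gradient (f i) x) (y - x)) ≤ ∑ i, f i y :=
    Finset.sum_le_sum fun i _ =>
      (le_add_of_nonneg_right (by positivity)).trans ((hf i).2 x y)
  rw [Finset.sum_add_distrib, ← sum_inner, hx, inner_zero_left, add_zero] at htangent
  exact mul_le_mul_of_nonneg_left htangent (by positivity)

section Basis

variable {ι E : Type*} [NormedAddCommGroup E] [InnerProductSpace ℝ E] (b : HilbertBasis ι ℝ E)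

lemma hilbertBasis_ext {x y : E} (h : ∀ j, inner ℝ (b j) x = inner ℝ (b j) y) : x = y :=
  b.repr.injective <| lp.ext <| funext fun j => by simpa only [b.repr_apply_apply] using h j

lemma hasSum_inner_sq (x : E) : HasSum (fun j => inner ℝ (b j) x ^ 2) (‖x‖ ^ 2) := by
  have h := b.hasSum_inner_mul_inner x x
  simp only [real_inner_self_eq_norm_sq, real_inner_comm _ x] at h
  simpa only [sq] using h

lemma exists_inner_eq {u : ι → ℝ} (hu : Summable fun j => u j ^ 2) :
    ∃ x : E, ∀ j, inner ℝ (b j) x = u j := by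
  have hmem : Memℓp u 2 := (memℓp_gen_iff (by norm_num)).2 (by simpa using hu)
  exact ⟨b.repr.symm ⟨u, hmem⟩, fun j => by
    rw [← b.repr_apply_apply, LinearIsometryEquiv.apply_symm_apply]⟩

lemma orthonormal_units_smul {v : ι → E} (hv : Orthonormal ℝ v) (ε : ι → ℤˣ) :
    Orthonormal ℝ fun j => ε j • v j := by
  refine ⟨fun j => ?_, fun i j hij => ?_⟩
  · rcases Int.units_eq_one_or (ε j) with h | h <;> simp [h, hv.1 j]
  · rcases Int.units_eq_one_or (ε i) with h | h <;>
      rcases Int.units_eq_one_or (ε j) with h' | h' <;> simp [h, h', hv.2 hij]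

variable [CompleteSpace E]

/-- The basis `b` with its vectors permuted by `σ` and multiplied by the signs `ε`. -/
noncomputable def signedBasis (σ : Equiv.Perm ι) (ε : ι → ℤˣ) : HilbertBasis ι ℝ E :=
  HilbertBasis.mkOfOrthogonalEqBot
    (orthonormal_units_smul (b.orthonormal.comp σ σ.injective) ε) <| by
      refine (Submodule.eq_bot_iff _).2 fun x hx => hilbertBasis_ext b fun j => ?_
      have hxj := hx _ (Submodule.subset_span ⟨σ.symm j, rfl⟩)
      rcases Int.units_eq_one_or (ε (σ.symm j)) with h | h <;> simpa [h] using hxj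

/-- The isometry `(x_j) ↦ (ε_j x_{σ j})` in the coordinates of `b`. -/
noncomputable def signedPerm (σ : Equiv.Perm ι) (ε : ι → ℤˣ) : E ≃ₗᵢ[ℝ] E :=
  (signedBasis b σ ε).repr.trans b.repr.symm

lemma inner_signedPerm (σ : Equiv.Perm ι) (ε : ι → ℤˣ) (x : E) (j : ι) :
    inner ℝ (b j) (signedPerm b σ ε x) = ε j • inner ℝ (b (σ j)) x := by
  rw [← b.repr_apply_apply, signedPerm, LinearIsometryEquiv.trans_apply,
    LinearIsometryEquiv.apply_symm_apply, HilbertBasis.repr_apply_apply, signedBasis,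
    HilbertBasis.coe_mkOfOrthogonalEqBot]
  rcases Int.units_eq_one_or (ε j) with h | h <;> simp [h]

lemma inner_signedPerm_comm {σ : Equiv.Perm ι} {ε : ι → ℤˣ} (hσ : Function.Involutive σ)
    (hε : ∀ j, ε (σ j) = ε j) (x y : E) :
    inner ℝ (signedPerm b σ ε x) y = inner ℝ x (signedPerm b σ ε y) := by
  have hinv (z : E) : signedPerm b σ ε (signedPerm b σ ε z) = z :=
    hilbertBasis_ext b fun j => by
      rw [inner_signedPerm, inner_signedPerm, hσ, hε, smul_smul, Int.units_mul_self, one_smul]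
  conv_lhs => rw [← hinv y]
  exact LinearIsometryEquiv.inner_map_map _ _ _

end Basis

section Level

variable {E : Type*} [NormedAddCommGroup E] [InnerProductSpace ℝ E] (b : HilbertBasis ℕ ℝ E)

/-- The closed subspace of the vectors whose coordinates after the `m`-th vanish. -/
noncomputable def levelSpace (m : ℕ) : Submodule ℝ E :=
  (Submodule.span ℝ (b '' Set.Ioi m))ᗮ

variable {b}

lemma mem_levelSpace {m : ℕ} {x : E} : x ∈ levelSpace b m ↔ ∀ j, m < j → inner ℝ (b j) x = 0 := by
  refine ⟨fun hx j hj => hx _ (Submodule.subset_span ⟨j, hj, rfl⟩), fun hx => ?_⟩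
  have horth : Submodule.span ℝ {x} ⟂ Submodule.span ℝ (b '' Set.Ioi m) := by
    rw [Submodule.isOrtho_span]
    rintro _ rfl _ ⟨j, hj, rfl⟩
    rw [real_inner_comm, hx j hj]
  exact horth (Submodule.mem_span_singleton_self x)

variable (b) in
lemma levelSpace_mono : Monotone (levelSpace b) := fun _ _ h =>
  Submodule.orthogonal_le (Submodule.span_mono (Set.image_mono (Set.Ioi_subset_Ioi h)))

lemma signedPerm_mem_levelSpace [CompleteSpace E] {σ : Equiv.Perm ℕ} {ε : ℕ → ℤˣ} {m : ℕ}
    (hσ : ∀ j, m < j → m < σ j) {x : E} (hx : x ∈ levelSpace b m) :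
    signedPerm b σ ε x ∈ levelSpace b m :=
  mem_levelSpace.2 fun j hj => by
    rw [inner_signedPerm, mem_levelSpace.1 hx _ (hσ j hj), smul_zero]

instance [CompleteSpace E] (m : ℕ) : (levelSpace b m).HasOrthogonalProjection :=
  inferInstanceAs ((Submodule.span ℝ (b '' Set.Ioi m))ᗮ).HasOrthogonalProjection

lemma basis_mem_levelSpace {i m : ℕ} (h : i ≤ m) : b i ∈ levelSpace b m :=
  mem_levelSpace.2 fun _ hj => b.orthonormal.2 (h.trans_lt hj).ne'

/-- Reflect the first vector of an arbitrary basis onto the line of `x`. -/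
lemma exists_hilbertBasis_mem_levelSpace_zero (b : HilbertBasis ℕ ℝ E) (x : E) :
    ∃ b' : HilbertBasis ℕ ℝ E, x ∈ levelSpace b' 0 := by
  set R := ((ℝ ∙ (x - ‖x‖ • b 0))ᗮ).reflection
  have hRx : R x = ‖x‖ • b 0 :=
    Submodule.reflection_sub (by rw [norm_smul, norm_norm, b.orthonormal.1, mul_one])
  refine ⟨HilbertBasis.ofRepr (R.trans b.repr), mem_levelSpace.2 fun j hj => ?_⟩
  rw [← HilbertBasis.repr_apply_apply, LinearIsometryEquiv.trans_apply, hRx,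
    b.repr_apply_apply, inner_smul_right, b.orthonormal.2 hj.ne', mul_zero]

lemma exists_geometric_coordinates (b : HilbertBasis ℕ ℝ E) {q : ℝ} (hq₀ : 0 ≤ q) (hq₁ : q < 1) :
    ∃ z : E, inner ℝ (b 0) z = 0 ∧ ∀ j, inner ℝ (b (j + 1)) z = q ^ (j + 1) := by
  have hsum : Summable fun j => (if j = 0 then 0 else q ^ j) ^ 2 := by
    refine Summable.of_nonneg_of_le (fun j => sq_nonneg _) (fun j => ?_)
      (summable_geometric_of_lt_one hq₀ hq₁)
    split_ifs with hj
    · simp [hj]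
    · exact pow_le_of_le_one (by positivity) (pow_le_one₀ hq₀ hq₁.le) two_ne_zero
  obtain ⟨z, hz⟩ := exists_inner_eq b hsum
  exact ⟨z, by simpa using hz 0, fun j => by simpa using hz (j + 1)⟩

lemma pow_mul_norm_sq_le_norm_sub_sq {q : ℝ} {x₀ : E} (h₀ : x₀ ∈ levelSpace b 0) {z : E}
    (hz₀ : inner ℝ (b 0) z = 0) (hz : ∀ j, inner ℝ (b (j + 1)) z = q ^ (j + 1)) {m : ℕ} {x : E}
    (hx : x ∈ levelSpace b m) : (q ^ m) ^ 2 * ‖z‖ ^ 2 ≤ ‖x - (x₀ + z)‖ ^ 2 := by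
  refine hasSum_le_inj (fun j => j + m) (add_left_injective m) (fun _ _ => sq_nonneg _)
    (fun j => ?_) ((hasSum_inner_sq b z).mul_left ((q ^ m) ^ 2)) (hasSum_inner_sq b _)
  cases j with
  | zero =>
    rw [hz₀, zero_pow two_ne_zero, mul_zero]
    exact sq_nonneg _
  | succ j =>
    refine le_of_eq ?_
    rw [inner_sub_right, inner_add_right, mem_levelSpace.1 hx _ (by omega),
      mem_levelSpace.1 h₀ _ (by omega), hz, Nat.add_right_comm, hz]
    ring

lemma pow_sq_le_of_norm_sub_sq_le {q ε : ℝ} (hq : 0 < q) {x₀ : E} (h₀ : x₀ ∈ levelSpace b 0) {z : E}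
    (hz₀ : inner ℝ (b 0) z = 0) (hz : ∀ j, inner ℝ (b (j + 1)) z = q ^ (j + 1)) {m : ℕ} {x : E}
    (hx : x ∈ levelSpace b m) (hε : ‖x - (x₀ + z)‖ ^ 2 ≤ ε * ‖x₀ - (x₀ + z)‖ ^ 2) :
    (q ^ m) ^ 2 ≤ ε := by
  have hz_ne : z ≠ 0 := by
    rintro rfl
    have h := hz 0
    rw [inner_zero_right] at h
    exact (pow_pos hq _).ne h
  rw [sub_add_cancel_left, norm_neg] at hε
  exact le_of_mul_le_mul_right ((pow_mul_norm_sq_le_norm_sub_sq h₀ hz₀ hz hx).trans hε)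
    (by positivity)

end Level

section Chain

/-- The three kinds of local functions: `left` and `right` couple the coordinates with odd,
respectively even, left end; `middle` couples nothing. -/
inductive Role
  | left
  | right
  | middle
  deriving DecidableEq

instance : Fintype Role := ⟨{.left, .right, .middle}, by rintro (_ | _ | _) <;> decide⟩

lemma sum_role {M : Type*} [AddCommMonoid M] (u : Role → M) :
    ∑ c, u c = u .left + u .right + u .middle := by
  rw [add_assoc]
  exact (Finset.sum_insert (by decide)).trans (congrArg _ (Finset.sum_pair (by decide)))

/-- The coordinates coupled by the functions of each kind: `left` exchanges `2 ↔ 3`, `4 ↔ 5`, ...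
and `right` exchanges `1 ↔ 2`, `3 ↔ 4`, .... -/
def chainSwap : Role → ℕ → ℕ
  | .left, j => if j ≤ 1 then j else if Even j then j + 1 else j - 1
  | .right, j => if j = 0 then 0 else if Even j then j - 1 else j + 1
  | .middle, j => j

/-- The sign `-1` at the first coordinate of the `left` functions closes the chain there. -/
def chainSign (c : Role) (j : ℕ) : ℤˣ :=
  if c = .left ∧ j = 1 then -1 else 1

lemma chainSwap_involutive (c : Role) : Function.Involutive (chainSwap c) := by
  intro j
  cases c <;> simp only [chainSwap] <;> grind

lemma chainSign_chainSwap (c : Role) (j : ℕ) : chainSign c (chainSwap c j) = chainSign c j := by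
  have h : chainSwap .left j = 1 ↔ j = 1 := by simp only [chainSwap]; grind
  cases c <;> simp [chainSign, h]

/-- The levels whose coordinate space is invariant under the coupling of the given kind. -/
def IsClosedLevel : Role → ℕ → Prop
  | .left, m => Odd m
  | .right, m => Even m
  | .middle, _ => True

lemma IsClosedLevel.lt_chainSwap {c : Role} {m : ℕ} (hm : IsClosedLevel c m) {j : ℕ} (hj : m < j) :
    m < chainSwap c j := by
  cases c <;> simp only [chainSwap, IsClosedLevel] at hm ⊢ <;> grind

lemma chainSwap_left_add_right {R : Type*} [AddCommMonoid R] (u : ℕ → R) (j : ℕ) :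
    u (chainSwap .left (j + 2)) + u (chainSwap .right (j + 2)) = u (j + 1) + u (j + 3) := by
  by_cases h : Even j
  · have hl : chainSwap .left (j + 2) = j + 3 := by simp [chainSwap, Nat.even_add, h]
    have hr : chainSwap .right (j + 2) = j + 1 := by simp [chainSwap, Nat.even_add, h]
    rw [hl, hr, add_comm]
  · have hl : chainSwap .left (j + 2) = j + 1 := by simp [chainSwap, Nat.even_add, h]
    have hr : chainSwap .right (j + 2) = j + 3 := by simp [chainSwap, Nat.even_add, h]
    rw [hl, hr]

section Functions

variable {E : Type*} [NormedAddCommGroup E] [InnerProductSpace ℝ E]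
  (b : HilbertBasis ℕ ℝ E) (μ κ q : ℝ) (x₀ : E) (c : Role)

/-- The linear term of the local functions of kind `c`. -/
noncomputable def chainShift : E :=
  μ • x₀ + (if c = .left then 2 * κ * (1 + q) else 0) • b 1

variable {b μ κ q x₀ c} in
lemma chainShift_mem_levelSpace {m : ℕ} (hm : IsClosedLevel c m) (h₀ : x₀ ∈ levelSpace b 0) :
    chainShift b μ κ q x₀ c ∈ levelSpace b m := by
  refine Submodule.add_mem _ (Submodule.smul_mem _ _ (levelSpace_mono b m.zero_le h₀)) ?_
  split_ifs with hc
  · subst hc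
    exact Submodule.smul_mem _ _ (basis_mem_levelSpace hm.pos)
  · rw [zero_smul]
    exact Submodule.zero_mem _

variable [CompleteSpace E]

/-- The orthogonal involution `x_j ↔ x_{j+1}` on the pairs coupled by `c`. -/
noncomputable def chainInvolution : E ≃ₗᵢ[ℝ] E :=
  signedPerm b (chainSwap_involutive c).toPerm (chainSign c)

lemma inner_chainInvolution (x : E) (j : ℕ) :
    inner ℝ (b j) (chainInvolution b c x) = chainSign c j • inner ℝ (b (chainSwap c j)) x :=
  inner_signedPerm _ _ _ _ _

lemma inner_chainInvolution_comm (x y : E) :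
    inner ℝ (chainInvolution b c x) y = inner ℝ x (chainInvolution b c y) :=
  inner_signedPerm_comm b (chainSwap_involutive c) (chainSign_chainSwap c) x y

/-- The Hessian `μ + 2κ (1 - S)` of the local functions, `S` being the coupling of kind `c`. -/
noncomputable def chainHessian : E →L[ℝ] E :=
  (μ + 2 * κ) • ContinuousLinearMap.id ℝ E -
    (2 * κ) • (chainInvolution b c).toContinuousLinearEquiv.toContinuousLinearMap

lemma chainHessian_apply (x : E) :
    chainHessian b μ κ c x = (μ + 2 * κ) • x - (2 * κ) • chainInvolution b c x := rfl

lemma isSymmetric_chainHessian : (chainHessian b μ κ c : E →ₗ[ℝ] E).IsSymmetric := by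
  intro x y
  simp only [ContinuousLinearMap.coe_coe, chainHessian_apply, inner_sub_left, inner_sub_right,
    real_inner_smul_left, real_inner_smul_right, inner_chainInvolution_comm]

variable {b μ κ q x₀ c}

lemma norm_chainHessian_le (hμ : 0 ≤ μ) (hκ : 0 ≤ κ) (x : E) :
    ‖chainHessian b μ κ c x‖ ≤ (μ + 4 * κ) * ‖x‖ := by
  rw [chainHessian_apply]
  refine (norm_sub_le _ _).trans_eq ?_
  rw [norm_smul, norm_smul, Real.norm_of_nonneg (by positivity),
    Real.norm_of_nonneg (by positivity), LinearIsometryEquiv.norm_map]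
  ring

lemma le_inner_chainHessian (hκ : 0 ≤ κ) (x : E) :
    μ * ‖x‖ ^ 2 ≤ inner ℝ (chainHessian b μ κ c x) x := by
  have hS : inner ℝ (chainInvolution b c x) x ≤ ‖x‖ ^ 2 :=
    (real_inner_le_norm _ _).trans_eq (by rw [LinearIsometryEquiv.norm_map, sq])
  rw [chainHessian_apply, inner_sub_left, real_inner_smul_left, real_inner_smul_left,
    real_inner_self_eq_norm_sq]
  nlinarith

lemma chainHessian_mem_levelSpace {m : ℕ} (hm : IsClosedLevel c m) {x : E}
    (hx : x ∈ levelSpace b m) : chainHessian b μ κ c x ∈ levelSpace b m :=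
  Submodule.sub_mem _ (Submodule.smul_mem _ _ hx) <| Submodule.smul_mem _ _ <|
    signedPerm_mem_levelSpace (fun _ => hm.lt_chainSwap) hx

variable (b μ κ q x₀ c)

/-- The local functions. Up to a translation by `x₀`, their mean is a chain quadratic whose
minimizer has the coordinates `0, q, q², …`. -/
noncomputable def chainFunction : E → ℝ :=
  quadratic (chainHessian b μ κ c) (chainShift b μ κ q x₀ c)

variable {b μ κ q x₀ c}

variable (q) in
lemma inner_gradient_chainFunction (x : E) (j : ℕ) :
    inner ℝ (b j) (gradient (chainFunction b μ κ q x₀ c) (x₀ + x)) =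
      μ * inner ℝ (b j) x + 2 * κ * (inner ℝ (b j) (x₀ + x) -
        chainSign c j • inner ℝ (b (chainSwap c j)) (x₀ + x)) -
      (if c = .left ∧ j = 1 then 2 * κ * (1 + q) else 0) := by
  have hb : inner ℝ (b j) (b 1) = if j = 1 then (1 : ℝ) else 0 :=
    orthonormal_iff_ite.1 b.orthonormal j 1
  rw [chainFunction, gradient_quadratic (isSymmetric_chainHessian b μ κ c), chainHessian_apply,
    chainShift]
  simp only [inner_sub_right, inner_add_right, real_inner_smul_right, inner_chainInvolution, hb]
  rw [ite_and]
  split_ifs <;> ring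

/-- The equation `3μq = 2κ(1-q)²` makes `q^j` a solution of the recursion
`3μ u_j = 2κ (u_{j-1} - 2 u_j + u_{j+1})`. -/
lemma sum_gradient_chainFunction_eq_zero (h₀ : x₀ ∈ levelSpace b 0)
    (hq : 3 * μ * q = 2 * κ * (1 - q) ^ 2) {z : E} (hz₀ : inner ℝ (b 0) z = 0)
    (hz : ∀ j, inner ℝ (b (j + 1)) z = q ^ (j + 1)) :
    ∑ c, gradient (chainFunction b μ κ q x₀ c) (x₀ + z) = 0 := by
  have hx₀ (j : ℕ) : inner ℝ (b (j + 1)) (x₀ + z) = q ^ (j + 1) := by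
    rw [inner_add_right, mem_levelSpace.1 h₀ _ j.succ_pos, zero_add, hz]
  refine hilbertBasis_ext b fun j => ?_
  rw [sum_role, inner_add_right, inner_add_right, inner_zero_right]
  simp only [inner_gradient_chainFunction]
  match j with
  | 0 => simp [chainSwap, chainSign, hz₀]
  | 1 =>
    simp only [hz 0, zero_add, pow_one, hx₀ 0, chainSign, and_self, ↓reduceIte, chainSwap,
      Std.le_refl, Units.neg_smul, one_smul, sub_neg_eq_add, reduceCtorEq, and_true, one_ne_zero,
      Nat.not_even_one, Nat.reduceAdd, hx₀ 1, sub_zero, sub_self, mul_zero, add_zero]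
    linear_combination hq
  | j + 2 =>
    have hcouple := chainSwap_left_add_right (fun i => inner ℝ (b i) (x₀ + z)) j
    simp only [hx₀] at hcouple
    have hmiddle : chainSwap .middle (j + 2) = j + 2 := rfl
    simp only [hz (j + 1), hx₀ (j + 1), chainSign, Nat.reduceEqDiff, and_false, ↓reduceIte,
      one_smul, sub_zero, reduceCtorEq, and_self, hmiddle, sub_self, mul_zero, add_zero]
    linear_combination q ^ (j + 1) * hq - 2 * κ * hcouple

end Functions

end Chain

/-- The rate `q = exp (-2 arsinh (√β / 2))` satisfies `q^(-1/2) - q^(1/2) = √β`. -/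
lemma exists_chain_rate {β : ℝ} (hβ : 0 < β) :
    ∃ q : ℝ, 0 < q ∧ q < 1 ∧ β * q = (1 - q) ^ 2 ∧ Real.log (1 / q) ≤ √β := by
  set t := Real.arsinh (√β / 2) with ht
  have ht₀ : 0 < t := Real.arsinh_pos_iff.2 (by positivity)
  have hsinh : Real.exp t - Real.exp (-t) = √β := by
    have h := Real.sinh_arsinh (√β / 2)
    rw [← ht, Real.sinh_eq] at h
    linarith
  have hinv : Real.exp t * Real.exp (-t) = 1 := by
    rw [← Real.exp_add, add_neg_cancel, Real.exp_zero]
  refine ⟨Real.exp (-t) ^ 2, by positivity, ?_, ?_, ?_⟩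
  · exact pow_lt_one₀ (Real.exp_pos _).le (Real.exp_lt_one_iff.2 (by linarith)) two_ne_zero
  · rw [← Real.sq_sqrt hβ.le, ← hsinh]
    linear_combination (Real.exp t * Real.exp (-t) + 1 - 2 * Real.exp (-t) ^ 2) * hinv
  · have hle : t ≤ √β / 2 := by
      have h := Real.self_le_sinh_iff.2 ht₀.le
      rwa [ht, Real.sinh_arsinh] at h
    rw [one_div, Real.log_inv, Real.log_pow, Real.log_exp]
    push_cast
    linarith

open Matrix

section Spectrum

variable {ι : Type*} [Fintype ι] {A : Matrix ι ι ℝ}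

lemma mem_spectrum_iff_exists_mulVec [DecidableEq ι] {l : ℝ} :
    l ∈ spectrum ℝ A ↔ ∃ x : ι → ℝ, x ≠ 0 ∧ A *ᵥ x = l • x := by
  rw [← Matrix.spectrum_toLin', ← Module.End.hasEigenvalue_iff_mem_spectrum]
  refine ⟨fun h => ?_, fun ⟨x, hx, hA⟩ => ?_⟩
  · obtain ⟨x, hx⟩ := h.exists_hasEigenvector
    exact ⟨x, hx.2, hx.apply_eq_smul⟩
  · exact Module.End.hasEigenvalue_of_hasEigenvector
      (Module.End.hasEigenvector_iff.2 ⟨Module.End.mem_eigenspace_iff.2 hA, hx⟩)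

lemma dotProduct_eq_zero_of_mulVec_eq_smul (hA : A.IsHermitian) {x y : ι → ℝ} {l m : ℝ}
    (hx : A *ᵥ x = l • x) (hy : A *ᵥ y = m • y) (hlm : l ≠ m) : x ⬝ᵥ y = 0 := by
  have hsymm : x ⬝ᵥ A *ᵥ y = (A *ᵥ x) ⬝ᵥ y := by
    rw [dotProduct_mulVec, ← mulVec_transpose, ← conjTranspose_eq_transpose_of_trivial, hA]
  rw [hx, hy, dotProduct_smul, smul_dotProduct, smul_eq_mul, smul_eq_mul] at hsymm
  have hmul : (l - m) * (x ⬝ᵥ y) = 0 := by linarith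
  exact (mul_eq_zero.1 hmul).resolve_left (sub_ne_zero.2 hlm)

lemma dotProduct_self_pos {x : ι → ℝ} (hx : x ≠ 0) : 0 < x ⬝ᵥ x :=
  dotProduct_self_star_pos_iff.2 hx

lemma isGreatest_spectrum_of_dotProduct_le [DecidableEq ι] (hA : A.IsHermitian) {β : ℝ} {v : ι → ℝ}
    (hv₀ : v ≠ 0) (hv : A *ᵥ v = β • v)
    (hle : ∀ x, x ⬝ᵥ v = 0 → x ⬝ᵥ A *ᵥ x ≤ β * (x ⬝ᵥ x)) : IsGreatest (spectrum ℝ A) β := by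
  refine ⟨mem_spectrum_iff_exists_mulVec.2 ⟨v, hv₀, hv⟩, fun l hl => ?_⟩
  obtain ⟨x, hx₀, hx⟩ := mem_spectrum_iff_exists_mulVec.1 hl
  by_contra! hlt
  have hform := hle x (dotProduct_eq_zero_of_mulVec_eq_smul hA hx hv hlt.ne')
  rw [hx, dotProduct_smul, smul_eq_mul] at hform
  exact hlt.not_ge (le_of_mul_le_mul_right hform (dotProduct_self_pos hx₀))

/-- The symmetric matrix `A` annihilates the constants, has the eigenvector `u` with positive
eigenvalue `α`, and its quadratic form is at least `α` on the orthogonal complement of `1` and `u`.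
So `α` is the least positive eigenvalue of `A`. -/
structure HasSpectralGap (A : Matrix ι ι ℝ) (α : ℝ) (u : ι → ℝ) : Prop where
  isHermitian : A.IsHermitian
  pos : 0 < α
  mulVec_one : A *ᵥ 1 = 0
  ne_zero : u ≠ 0
  mulVec_eq : A *ᵥ u = α • u
  le_dotProduct : ∀ x, x ⬝ᵥ 1 = 0 → x ⬝ᵥ u = 0 → α * (x ⬝ᵥ x) ≤ x ⬝ᵥ A *ᵥ x

namespace HasSpectralGap

variable {α : ℝ} {u : ι → ℝ}

lemma le_of_mulVec_eq_smul (h : HasSpectralGap A α u) {l : ℝ} {x : ι → ℝ} (hx : A *ᵥ x = l • x)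
    (hx₀ : x ≠ 0) (hx₁ : x ⬝ᵥ 1 = 0) : α ≤ l := by
  by_contra! hlt
  have hform := h.le_dotProduct x hx₁
    (dotProduct_eq_zero_of_mulVec_eq_smul h.isHermitian hx h.mulVec_eq hlt.ne)
  rw [hx, dotProduct_smul, smul_eq_mul] at hform
  exact hlt.not_ge (le_of_mul_le_mul_right hform (dotProduct_self_pos hx₀))

lemma eq_zero_or_le_of_mem_spectrum [DecidableEq ι] (h : HasSpectralGap A α u) {l : ℝ}
    (hl : l ∈ spectrum ℝ A) : l = 0 ∨ α ≤ l := by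
  obtain ⟨x, hx₀, hx⟩ := mem_spectrum_iff_exists_mulVec.1 hl
  refine or_iff_not_imp_left.2 fun hl₀ => h.le_of_mulVec_eq_smul hx hx₀ ?_
  exact dotProduct_eq_zero_of_mulVec_eq_smul h.isHermitian hx
    (h.mulVec_one.trans (zero_smul ℝ _).symm) hl₀

lemma posSemidef (h : HasSpectralGap A α u) : A.PosSemidef := by
  classical
  rw [h.isHermitian.posSemidef_iff_eigenvalues_nonneg]
  intro i
  obtain h₀ | h₀ := h.eq_zero_or_le_of_mem_spectrum (h.isHermitian.eigenvalues_mem_spectrum_real i)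
  · exact h₀.ge
  · exact h.pos.le.trans h₀

lemma isLeast_spectrum_pos [DecidableEq ι] (h : HasSpectralGap A α u) :
    IsLeast {l : ℝ | l ∈ spectrum ℝ A ∧ 0 < l} α :=
  ⟨⟨mem_spectrum_iff_exists_mulVec.2 ⟨u, h.ne_zero, h.mulVec_eq⟩, h.pos⟩,
    fun _ hl => (h.eq_zero_or_le_of_mem_spectrum hl.1).resolve_left hl.2.ne'⟩

lemma mulVec_eq_zero_iff (h : HasSpectralGap A α u) {x : ι → ℝ} :
    A *ᵥ x = 0 ↔ ∀ i j, x i = x j := by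
  have hconst (c : ℝ) : A *ᵥ (c • 1) = 0 := by rw [mulVec_smul, h.mulVec_one, smul_zero]
  refine ⟨fun hx i j => ?_, fun hx => ?_⟩
  · have : Nonempty ι := ⟨i⟩
    set c : ℝ := (x ⬝ᵥ 1) / Fintype.card ι with hc
    have hmean : (x - c • 1) ⬝ᵥ 1 = 0 := by
      rw [sub_dotProduct, smul_dotProduct, one_dotProduct_one, smul_eq_mul, hc,
        div_mul_cancel₀ _ (Nat.cast_ne_zero.2 Fintype.card_ne_zero), sub_self]
    have hker : A *ᵥ (x - c • 1) = (0 : ℝ) • (x - c • 1) := by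
      rw [mulVec_sub, hx, hconst, sub_self, zero_smul]
    have hzero : x - c • 1 = 0 := by
      by_contra hne
      exact h.pos.not_ge (h.le_of_mulVec_eq_smul hker hne hmean)
    rw [sub_eq_zero.1 hzero]
    rfl
  · cases isEmpty_or_nonempty ι
    · exact Subsingleton.elim _ _
    · obtain ⟨i⟩ := ‹Nonempty ι›
      rw [show x = x i • 1 from funext fun j => by simp [hx j i], hconst]

end HasSpectralGap

section Relabel

variable {n : ℕ} (e : Fin n ≃ ι)

lemma isGossipMatrix_submatrix {G : SimpleGraph ι} (hG : ∀ i j, i ≠ j → ¬ G.Adj i j → A i j = 0)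
    (hA : ∀ x : ι → ℝ, A *ᵥ x = 0 ↔ ∀ i j, x i = x j) :
    IsGossipMatrix (G.comap e) (A.submatrix e e) := by
  refine ⟨fun i j hij hadj => hG _ _ (e.injective.ne hij) hadj, fun x => ?_⟩
  have hzero : (A *ᵥ (x ∘ e.symm)) ∘ e = 0 ↔ A *ᵥ (x ∘ e.symm) = 0 :=
    e.surjective.injective_comp_right.eq_iff' rfl
  rw [submatrix_mulVec_equiv, hzero, hA]
  simp only [Function.comp_apply, e.symm.forall_congr_left, Equiv.symm_symm, Equiv.symm_apply_apply]

lemma conditionNumber_submatrix [DecidableEq ι] {α β : ℝ} (hβ : IsGreatest (spectrum ℝ A) β)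
    (hα : IsLeast {l : ℝ | l ∈ spectrum ℝ A ∧ 0 < l} α) :
    conditionNumber (A.submatrix e e) = β / α := by
  have hs : spectrum ℝ (A.submatrix e e) = spectrum ℝ A :=
    AlgEquiv.spectrum_eq (Matrix.reindexAlgEquiv ℝ ℝ e.symm) A
  rw [conditionNumber, hs, hβ.csSup_eq, hα.csInf_eq]

end Relabel

end Spectrum

section EdgeLaplacian

variable {ι κ : Type*} (ends : κ → ι × ι)

/-- The graph with the edges `ends e`; loops are dropped. -/
def edgeGraph : SimpleGraph ι :=
  SimpleGraph.fromEdgeSet (Set.range fun e => s((ends e).1, (ends e).2))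

lemma edgeGraph_adj {i j : ι} :
    (edgeGraph ends).Adj i j ↔ (∃ e, s((ends e).1, (ends e).2) = s(i, j)) ∧ i ≠ j :=
  SimpleGraph.fromEdgeSet_adj _

variable [DecidableEq ι]

/-- The difference of the unit vectors at `i` and `j`. -/
def edgeVec (i j : ι) : ι → ℝ := Pi.single i 1 - Pi.single j 1

lemma edgeVec_ne_zero {i j : ι} (h : i ≠ j) : edgeVec i j ≠ 0 := fun h₀ => by
  simpa [edgeVec, h] using congrFun h₀ i

variable [Fintype κ] (w : κ → ℝ)

/-- The Laplacian of the graph with edges `ends e` of weight `w e`, which may be negative. -/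
def edgeLaplacian : Matrix ι ι ℝ :=
  ∑ e, w e • vecMulVec (edgeVec (ends e).1 (ends e).2) (edgeVec (ends e).1 (ends e).2)

lemma isHermitian_edgeLaplacian : (edgeLaplacian ends w).IsHermitian := by
  refine IsHermitian.ext fun i j => ?_
  simp only [edgeLaplacian, Matrix.sum_apply, Matrix.smul_apply, vecMulVec_apply, star_trivial,
    mul_comm]

lemma edgeLaplacian_apply_eq_zero {i j : ι} (hij : i ≠ j) (hadj : ¬ (edgeGraph ends).Adj i j) :
    edgeLaplacian ends w i j = 0 := by
  have hends (e : κ) : s((ends e).1, (ends e).2) ≠ s(i, j) := fun h =>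
    hadj ((edgeGraph_adj ends).2 ⟨⟨e, h⟩, hij⟩)
  rw [edgeLaplacian, Matrix.sum_apply]
  refine Finset.sum_eq_zero fun e _ => ?_
  have := hends e
  rw [Matrix.smul_apply, vecMulVec_apply]
  simp only [edgeVec, Pi.sub_apply, Pi.single_apply, smul_eq_mul]
  grind

variable [Fintype ι]

lemma edgeVec_dotProduct (i j : ι) (x : ι → ℝ) : edgeVec i j ⬝ᵥ x = x i - x j := by
  rw [edgeVec, sub_dotProduct, single_one_dotProduct, single_one_dotProduct]

lemma edgeLaplacian_mulVec (x : ι → ℝ) :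
    edgeLaplacian ends w *ᵥ x =
      ∑ e, (w e * (x (ends e).1 - x (ends e).2)) • edgeVec (ends e).1 (ends e).2 := by
  simp only [edgeLaplacian, sum_mulVec, smul_mulVec, vecMulVec_mulVec, edgeVec_dotProduct,
    op_smul_eq_smul, smul_smul]

lemma edgeLaplacian_mulVec_one : edgeLaplacian ends w *ᵥ 1 = 0 := by
  simp [edgeLaplacian_mulVec]

lemma dotProduct_edgeLaplacian_mulVec (x : ι → ℝ) :
    x ⬝ᵥ edgeLaplacian ends w *ᵥ x = ∑ e, w e * (x (ends e).1 - x (ends e).2) ^ 2 := by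
  rw [edgeLaplacian_mulVec, dotProduct_comm, sum_dotProduct]
  simp only [smul_dotProduct, edgeVec_dotProduct, smul_eq_mul, sq, mul_assoc]

end EdgeLaplacian

section SumSq

variable {ι : Type*} [Fintype ι]

lemma sub_sq_le_two_mul_dotProduct_self (x : ι → ℝ) (i j : ι) :
    (x i - x j) ^ 2 ≤ 2 * (x ⬝ᵥ x) := by
  classical
  have hnonneg (k : ι) : 0 ≤ x k * x k := mul_self_nonneg _
  rcases eq_or_ne i j with rfl | hij
  · rw [sub_self, zero_pow two_ne_zero]
    exact mul_nonneg zero_le_two (Finset.sum_nonneg fun k _ => hnonneg k)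
  · have hpair : x i * x i + x j * x j ≤ x ⬝ᵥ x := by
      rw [← Finset.sum_pair (f := fun k => x k * x k) hij]
      exact Finset.sum_le_univ_sum_of_nonneg hnonneg
    nlinarith [sq_nonneg (x i + x j)]

lemma dotProduct_self_le_sum_sub_sq {x : ι → ℝ} (hx : x ⬝ᵥ 1 = 0) (c : ℝ) :
    x ⬝ᵥ x ≤ ∑ v, (x v - c) ^ 2 := by
  rw [dotProduct_one] at hx
  have hexpand : ∑ v, (x v - c) ^ 2 = x ⬝ᵥ x - 2 * c * ∑ v, x v + Fintype.card ι * c ^ 2 := by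
    simp only [dotProduct, Finset.mul_sum, ← Finset.sum_sub_distrib, ← nsmul_eq_mul,
      ← Finset.card_univ, ← Finset.sum_const, ← Finset.sum_add_distrib]
    exact Finset.sum_congr rfl fun v _ => by ring
  rw [hexpand, hx]
  have : 0 ≤ (Fintype.card ι : ℝ) * c ^ 2 := by positivity
  linarith

end SumSq

section TwinTree

variable {ι : Type*} (par : ι → ι)

/-- The map `par` describes a tree of depth two, with root `r`, in which the leaves
`leaf (s, false)` and `leaf (s, true)` are siblings for both `s`. Joining such twins by an edge
changes one eigenvalue of the Laplacian and no eigenvector, and this is how its extreme positive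
eigenvalues are prescribed. -/
structure IsTwinTree (r : ι) (leaf : Bool × Bool → ι) : Prop where
  par_par : ∀ v, par (par v) = r
  par_leaf : ∀ s, par (leaf (s, false)) = par (leaf (s, true))
  par_ne_leaf : ∀ v t, par v ≠ leaf t
  injective : Function.Injective leaf

variable (leaf : Bool × Bool → ι) (β : ℝ)

/-- The edges of a tree given by parents, together with the two edges between twin leaves. The root
is its own parent and so has a loop, which contributes nothing. -/
def twinTreeEnds : ι ⊕ Bool → ι × ι :=
  Sum.elim (fun v => (v, par v)) fun s => (leaf (s, false), leaf (s, true))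

/-- The weight of the edge between twin leaves that makes `β` (for `true`) or `1 / 2` (for `false`)
an eigenvalue. -/
noncomputable def twinWeight : Bool → ℝ
  | true => (β - 1) / 2
  | false => -(1 / 4)

variable {par leaf} {r : ι}

namespace IsTwinTree

lemma par_root (h : IsTwinTree par r leaf) : par r = r := by
  rw [← h.par_par (par r), h.par_par, h.par_par]

lemma leaf_ne (h : IsTwinTree par r leaf) (s : Bool) : leaf (s, false) ≠ leaf (s, true) :=
  h.injective.ne (by simp)

end IsTwinTree

variable [DecidableEq ι]

variable (leaf) in
/-- The vector that distinguishes the twins `leaf (s, false)` and `leaf (s, true)`. -/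
def twinVec (s : Bool) : ι → ℝ :=
  edgeVec (leaf (s, false)) (leaf (s, true))

namespace IsTwinTree

lemma twinVec_apply_par (h : IsTwinTree par r leaf) (s : Bool) (v : ι) :
    twinVec leaf s (par v) = 0 := by
  simp [twinVec, edgeVec, h.par_ne_leaf]

lemma twinVec_leaf_sub (h : IsTwinTree par r leaf) (s t : Bool) :
    twinVec leaf s (leaf (t, false)) - twinVec leaf s (leaf (t, true)) =
      if t = s then 2 else 0 := by
  simp only [twinVec, edgeVec, Pi.sub_apply, Pi.single_apply, h.injective.eq_iff, Prod.mk.injEq]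
  cases s <;> cases t <;> norm_num

end IsTwinTree

variable [Fintype ι] (par)

/-- The weight of the edge from `v` to its parent: the number of nodes whose path to the root of a
tree of depth two uses this edge. -/
def treeWeight (v : ι) : ℝ :=
  1 + (Finset.univ.filter fun u => par u = v).card

lemma one_le_treeWeight (v : ι) : 1 ≤ treeWeight par v :=
  le_add_of_nonneg_right (Nat.cast_nonneg _)

lemma treeWeight_eq_one {v : ι} (hv : ∀ u, par u ≠ v) : treeWeight par v = 1 := by
  simp [treeWeight, hv]

lemma sum_treeWeight_mul (g : ι → ℝ) :
    ∑ v, treeWeight par v * g v = ∑ v, g v + ∑ v, g (par v) := by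
  simp only [treeWeight, add_mul, one_mul, Finset.sum_add_distrib, ← nsmul_eq_mul]
  rw [← Finset.sum_fiberwise' Finset.univ par g]
  simp only [Finset.sum_const]

variable {par}

lemma sum_sub_root_sq_le (hpar : ∀ v, par (par v) = r) (x : ι → ℝ) :
    ∑ v, (x v - x r) ^ 2 ≤ 2 * ∑ v, treeWeight par v * (x v - x (par v)) ^ 2 := by
  rw [sum_treeWeight_mul par fun v => (x v - x (par v)) ^ 2, ← Finset.sum_add_distrib,
    Finset.mul_sum]
  refine Finset.sum_le_sum fun v _ => ?_
  rw [hpar]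
  nlinarith [sq_nonneg (x v - x (par v) - (x (par v) - x r))]

lemma sum_treeWeight_mul_sq_le (hr : par r = r) (x : ι → ℝ) :
    ∑ v, treeWeight par v * (x v - x (par v)) ^ 2 ≤
      2 * (2 * Fintype.card ι - treeWeight par r) * (x ⬝ᵥ x) := by
  have htotal : ∑ v, treeWeight par v = 2 * Fintype.card ι := by
    have hsum := sum_treeWeight_mul par 1
    simp only [Pi.one_apply, mul_one, Finset.sum_const, Finset.card_univ, nsmul_eq_mul] at hsum
    linarith
  calc ∑ v, treeWeight par v * (x v - x (par v)) ^ 2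
      = ∑ v ∈ Finset.univ.erase r, treeWeight par v * (x v - x (par v)) ^ 2 := by
        refine (Finset.sum_erase _ ?_).symm
        rw [hr, sub_self, zero_pow two_ne_zero, mul_zero]
    _ ≤ ∑ v ∈ Finset.univ.erase r, treeWeight par v * (2 * (x ⬝ᵥ x)) :=
        Finset.sum_le_sum fun v _ => mul_le_mul_of_nonneg_left
          (sub_sq_le_two_mul_dotProduct_self x _ _) (zero_le_one.trans (one_le_treeWeight par v))
    _ = 2 * (2 * Fintype.card ι - treeWeight par r) * (x ⬝ᵥ x) := by
        rw [← Finset.sum_mul, Finset.sum_erase_eq_sub (Finset.mem_univ r), htotal]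
        ring

variable (par leaf)

/-- The Laplacian of a twin tree with extreme positive eigenvalues `β` and `1 / 2`. -/
noncomputable def twinLaplacian : Matrix ι ι ℝ :=
  edgeLaplacian (twinTreeEnds par leaf) (Sum.elim (treeWeight par) (twinWeight β))

lemma isHermitian_twinLaplacian : (twinLaplacian par leaf β).IsHermitian :=
  isHermitian_edgeLaplacian _ _

lemma dotProduct_twinLaplacian_mulVec (x : ι → ℝ) :
    x ⬝ᵥ twinLaplacian par leaf β *ᵥ x =
      ∑ v, treeWeight par v * (x v - x (par v)) ^ 2 +
        ∑ s, twinWeight β s * (x ⬝ᵥ twinVec leaf s) ^ 2 := by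
  rw [twinLaplacian, dotProduct_edgeLaplacian_mulVec, Fintype.sum_sum_type]
  simp only [twinTreeEnds, Sum.elim_inl, Sum.elim_inr, twinVec, dotProduct_comm x,
    edgeVec_dotProduct]

namespace IsTwinTree

variable {par leaf} {β} (h : IsTwinTree par r leaf)
include h

lemma treeWeight_mul_twinVec (s : Bool) (v : ι) :
    treeWeight par v * twinVec leaf s v = twinVec leaf s v := by
  by_cases hv : ∃ u, par u = v
  · obtain ⟨u, rfl⟩ := hv
    rw [h.twinVec_apply_par, mul_zero]
  · rw [treeWeight_eq_one par (not_exists.1 hv), one_mul]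

lemma twinLaplacian_mulVec_twinVec (s : Bool) :
    twinLaplacian par leaf β *ᵥ twinVec leaf s = (1 + 2 * twinWeight β s) • twinVec leaf s := by
  have htree : ∑ v, twinVec leaf s v • edgeVec v (par v) = twinVec leaf s := by
    simp only [edgeVec, smul_sub, Finset.sum_sub_distrib]
    have hpar : ∑ v, twinVec leaf s v • (Pi.single (par v) 1 : ι → ℝ) = 0 := by
      have hsib := h.par_leaf s
      simp [twinVec, edgeVec, Pi.single_apply, sub_smul, Finset.sum_sub_distrib, ite_smul, hsib]
    rw [hpar, sub_zero]
    exact (pi_eq_sum_univ' _).symm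
  have htwin : ∑ t, (twinWeight β t * if t = s then 2 else 0) • twinVec leaf t =
      (2 * twinWeight β s) • twinVec leaf s := by
    simp [mul_comm]
  rw [twinLaplacian, edgeLaplacian_mulVec, Fintype.sum_sum_type, add_smul, one_smul]
  simp only [twinTreeEnds, Sum.elim_inl, Sum.elim_inr, h.twinVec_apply_par, sub_zero,
    h.treeWeight_mul_twinVec, h.twinVec_leaf_sub]
  exact congrArg₂ _ htree htwin

lemma hasSpectralGap (hβ : 1 ≤ β) :
    HasSpectralGap (twinLaplacian par leaf β) (1 / 2) (twinVec leaf false) where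
  isHermitian := isHermitian_twinLaplacian par leaf β
  pos := by norm_num
  mulVec_one := edgeLaplacian_mulVec_one _ _
  ne_zero := edgeVec_ne_zero (h.leaf_ne false)
  mulVec_eq := by
    rw [h.twinLaplacian_mulVec_twinVec, twinWeight]
    norm_num
  le_dotProduct x hx₁ hx := by
    have htop : 0 ≤ (β - 1) / 2 * (x ⬝ᵥ twinVec leaf true) ^ 2 :=
      mul_nonneg (by linarith) (sq_nonneg _)
    have htree := (dotProduct_self_le_sum_sub_sq hx₁ (x r)).trans (sum_sub_root_sq_le h.par_par x)
    rw [dotProduct_twinLaplacian_mulVec, Fintype.sum_bool, hx]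
    simp only [twinWeight]
    linarith

lemma isGreatest_spectrum (hβ : 2 * (2 * Fintype.card ι - treeWeight par r) ≤ β) :
    IsGreatest (spectrum ℝ (twinLaplacian par leaf β)) β := by
  refine isGreatest_spectrum_of_dotProduct_le (isHermitian_twinLaplacian par leaf β)
    (edgeVec_ne_zero (h.leaf_ne true)) (v := twinVec leaf true) ?_ fun x hx => ?_
  · rw [h.twinLaplacian_mulVec_twinVec, twinWeight]
    congr 1
    ring
  · have htree := (sum_treeWeight_mul_sq_le h.par_root x).trans
      (mul_le_mul_of_nonneg_right hβ (Finset.sum_nonneg fun v _ => mul_self_nonneg (x v)))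
    rw [dotProduct_twinLaplacian_mulVec, Fintype.sum_bool, hx]
    simp only [twinWeight]
    linarith [sq_nonneg (x ⬝ᵥ twinVec leaf false)]

end IsTwinTree

end TwinTree

section DoubleStar

variable {k : ℕ}

/-- The parents in the double star rooted at the linking node `(middle, p)`: the two centres
`(left, 0)` and `(right, 0)` are joined to the linking node, the other nodes `(middle, j)` to the
left centre for `j < p` and to the right one for `p < j`. -/
def starPar (p : Fin (k + 3)) (v : Role × Fin (k + 3)) : Role × Fin (k + 3) :=
  if v.1 = .middle then if v.2 < p then (.left, 0) else if p < v.2 then (.right, 0) else v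
  else if v.2 = 0 then (.middle, p) else (v.1, 0)

/-- The leaves of the double star that are joined to their twins: `1` and `2` at either centre. -/
def starLeaf (k : ℕ) (t : Bool × Bool) : Role × Fin (k + 3) :=
  (if t.1 then .right else .left, Fin.succ (if t.2 then 1 else 0))

/-- The double star whose centres are linked through `(middle, p)`, with its two twin edges. -/
def starGraph (p : Fin (k + 3)) : SimpleGraph (Role × Fin (k + 3)) :=
  edgeGraph (twinTreeEnds (starPar p) (starLeaf k))

lemma isTwinTree_starPar (p : Fin (k + 3)) :
    IsTwinTree (starPar p) (.middle, p) (starLeaf k) where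
  par_par v := by
    simp only [starPar]
    grind
  par_leaf s := by
    have hne (t) : (starLeaf k (s, t)).1 ≠ .middle := by cases s <;> simp [starLeaf]
    simp only [starPar, if_neg (hne _)]
    simp only [starLeaf, Fin.succ_ne_zero, if_false]
  par_ne_leaf v t h := by
    have hcoord : (starPar p v).1 = .middle ∨ (starPar p v).2 = 0 := by
      simp only [starPar]
      grind
    rw [h] at hcoord
    exact hcoord.elim (by simp only [starLeaf]; split_ifs <;> simp) (Fin.succ_ne_zero _)
  injective := by
    rintro ⟨s, t⟩ ⟨s', t'⟩ h
    simp only [starLeaf, Prod.mk.injEq, Fin.succ_inj] at h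
    cases s <;> cases s' <;> cases t <;> cases t' <;> simp at h ⊢

lemma treeWeight_starPar_root (p : Fin (k + 3)) : treeWeight (starPar p) (.middle, p) = 4 := by
  have hchildren : (Finset.univ.filter fun v => starPar p v = (.middle, p)) =
      {(.left, 0), (.right, 0), (.middle, p)} := by
    ext ⟨c, j⟩
    simp only [starPar, Finset.mem_insert, Finset.mem_singleton]
    cases c <;> grind
  rw [treeWeight, hchildren, Finset.card_insert_of_notMem (by simp), Finset.card_pair (by simp)]
  norm_num

lemma card_role_prod_fin (K : ℕ) : Fintype.card (Role × Fin K) = 3 * K := by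
  rw [Fintype.card_prod, Fintype.card_fin]
  rfl

lemma exists_starGraph_gossip {n : ℕ} (e : Fin n ≃ Role × Fin (k + 3)) {χ : ℝ}
    (hχ : 24 * (k : ℝ) + 56 ≤ χ) (p : Fin (k + 3)) :
    ∃ W, IsGossipMatrix ((starGraph p).comap e) W ∧ W.PosSemidef ∧ conditionNumber W = χ := by
  have htree := isTwinTree_starPar p
  have hgap := htree.hasSpectralGap (β := χ / 2) (by linarith)
  have htop : IsGreatest (spectrum ℝ (twinLaplacian (starPar p) (starLeaf k) (χ / 2))) (χ / 2) := by
    refine htree.isGreatest_spectrum ?_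
    rw [treeWeight_starPar_root, card_role_prod_fin]
    push_cast
    linarith
  refine ⟨(twinLaplacian (starPar p) (starLeaf k) (χ / 2)).submatrix e e,
    isGossipMatrix_submatrix e (fun _ _ => edgeLaplacian_apply_eq_zero _ _)
    fun _ => hgap.mulVec_eq_zero_iff, hgap.posSemidef.submatrix e, ?_⟩
  rw [conditionNumber_submatrix e htop hgap.isLeast_spectrum_pos]
  ring

lemma starGraph_adj_iff {p : Fin (k + 3)} {u v : Role × Fin (k + 3)} :
    (starGraph p).Adj u v ↔
      (starPar p u = v ∨ starPar p v = u ∨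
        ∃ s, s(starLeaf k (s, false), starLeaf k (s, true)) = s(u, v)) ∧ u ≠ v := by
  rw [starGraph, edgeGraph_adj, Sum.exists]
  simp only [twinTreeEnds, Sum.elim_inl, Sum.elim_inr, ← or_assoc]
  refine and_congr_left fun _ => or_congr_left ?_
  simp only [Sym2.eq_iff]
  grind

lemma starPar_eq_or_of_val_eq_succ {p p' : Fin (k + 3)} (h : (p' : ℕ) = p + 1)
    {v : Role × Fin (k + 3)} (hv : starPar p v ≠ v) :
    starPar p' v = starPar p v ∨ starPar p' (starPar p v) = v ∨ v = (.right, 0) := by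
  obtain ⟨c, j⟩ := v
  simp only [Fin.ext_iff, Fin.lt_def, starPar, ne_eq] at hv ⊢
  cases c <;> simp only [reduceCtorEq, ↓reduceIte, Fin.coe_ofNat_eq_mod, Nat.zero_mod,
    Fin.val_eq_zero_iff, Fin.val_fin_lt, Prod.mk.injEq] at hv ⊢ <;> grind

lemma starPar_eq_or_of_succ_eq_val {p p' : Fin (k + 3)} (h : (p' : ℕ) + 1 = p)
    {v : Role × Fin (k + 3)} (hv : starPar p v ≠ v) :
    starPar p' v = starPar p v ∨ starPar p' (starPar p v) = v ∨ v = (.left, 0) := by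
  obtain ⟨c, j⟩ := v
  simp only [Fin.ext_iff, Fin.lt_def, starPar, ne_eq] at hv ⊢
  cases c <;> simp only [reduceCtorEq, ↓reduceIte, Fin.coe_ofNat_eq_mod, Nat.zero_mod,
    Fin.val_eq_zero_iff, Fin.val_fin_lt, Prod.mk.injEq] at hv ⊢ <;> grind

lemma starGraph_adj_or {p p' : Fin (k + 3)} {w : Role × Fin (k + 3)}
    (hw : ∀ v, starPar p v ≠ v →
      starPar p' v = starPar p v ∨ starPar p' (starPar p v) = v ∨ v = w)
    {u v : Role × Fin (k + 3)} (huv : (starGraph p).Adj u v) :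
    (starGraph p').Adj u v ∨ s(u, v) = s(w, starPar p w) := by
  rw [starGraph_adj_iff] at huv ⊢
  rw [Sym2.eq_iff]
  have := hw u
  have := hw v
  grind

lemma ncard_symmDiff_edgeSet_le_of_val_eq_succ {p p' : Fin (k + 3)} (h : (p' : ℕ) = p + 1) :
    (symmDiff (starGraph p).edgeSet (starGraph p').edgeSet).ncard ≤ 2 := by
  have hpair : ({s((.right, 0), starPar p (.right, 0)), s((.left, 0), starPar p' (.left, 0))} :
      Set (Sym2 (Role × Fin (k + 3)))).ncard ≤ 2 :=
    (Set.ncard_insert_le _ _).trans (by rw [Set.ncard_singleton])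
  refine (Set.ncard_le_ncard fun e he => ?_).trans hpair
  induction e with | h u v => ?_
  rcases he with ⟨h₁, h₂⟩ | ⟨h₁, h₂⟩
  · exact Or.inl ((starGraph_adj_or (fun _ => starPar_eq_or_of_val_eq_succ h) h₁).resolve_left h₂)
  · exact Or.inr
      ((starGraph_adj_or (fun _ => starPar_eq_or_of_succ_eq_val h.symm) h₁).resolve_left h₂)

lemma ncard_symmDiff_edgeSet_le {p p' : Fin (k + 3)} (h₁ : (p' : ℕ) ≤ p + 1)
    (h₂ : (p : ℕ) ≤ p' + 1) :
    (symmDiff (starGraph p).edgeSet (starGraph p').edgeSet).ncard ≤ 2 := by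
  rcases lt_trichotomy (p : ℕ) p' with h | h | h
  · exact ncard_symmDiff_edgeSet_le_of_val_eq_succ (by omega)
  · rw [Fin.ext h, symmDiff_self]
    simp
  · rw [symmDiff_comm]
    exact ncard_symmDiff_edgeSet_le_of_val_eq_succ (by omega)

lemma ncard_symmDiff_comap_edgeSet_le {α β : Type*} [Finite β] {f : α → β}
    (hf : Function.Injective f) (G G' : SimpleGraph β) :
    (symmDiff (G.comap f).edgeSet (G'.comap f).edgeSet).ncard ≤
      (symmDiff G.edgeSet G'.edgeSet).ncard := by
  refine Set.ncard_le_ncard_of_injOn (Sym2.map f) (fun e he => ?_)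
    (Sym2.map.injective hf).injOn (Set.toFinite _)
  induction e with | h u v => ?_
  exact he

end DoubleStar

section Schedule

variable {k : ℕ}

/-- The linking node after `r` communication rounds: it moves to and fro through the middle. -/
def linkNode (k r : ℕ) : Fin (k + 3) :=
  if Even (r / (k + 3)) then Fin.ofNat (k + 3) r else (Fin.ofNat (k + 3) r).rev

lemma succ_div_mod {K : ℕ} (hK : 0 < K) (r : ℕ) :
    ((r + 1) / K = r / K ∧ (r + 1) % K = r % K + 1 ∧ r % K + 1 < K) ∨
      ((r + 1) / K = r / K + 1 ∧ (r + 1) % K = 0 ∧ r % K + 1 = K) := by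
  rcases (Nat.succ_le_of_lt (Nat.mod_lt r hK)).lt_or_eq with h | h
  · have hr : r + 1 = K * (r / K) + (r % K + 1) := by rw [← add_assoc, Nat.div_add_mod]
    refine Or.inl ⟨?_, ?_, h⟩
    · rw [hr, Nat.mul_add_div hK, Nat.div_eq_of_lt h, add_zero]
    · rw [hr, Nat.mul_add_mod, Nat.mod_eq_of_lt h]
  · have hr : r + 1 = K * (r / K + 1) := by
      have := Nat.div_add_mod r K
      rw [mul_add_one]
      omega
    exact Or.inr ⟨by rw [hr, Nat.mul_div_cancel_left _ hK], by rw [hr, Nat.mul_mod_right], h⟩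

lemma linkNode_succ (k r : ℕ) :
    (linkNode k (r + 1) : ℕ) ≤ linkNode k r + 1 ∧ (linkNode k r : ℕ) ≤ linkNode k (r + 1) + 1 := by
  unfold linkNode
  rcases succ_div_mod (K := k + 3) (by omega) r with ⟨hdiv, hmod, hlt⟩ | ⟨hdiv, hmod, hlt⟩ <;>
    simp only [Fin.ofNat, hdiv, hmod, Nat.even_add_one] <;>
    split_ifs <;> simp only [Fin.val_rev] <;> omega

/-- The nodes that can already hold the next coordinate during the crossing `t`, when the linking
node is `p`: it comes from the `left` star if `t` is even, and from the `right` star if `t` is odd.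
The nodes `(middle, j)` with `j < p` are then leaves of the `left` star, those with `p < j` leaves
of the `right` one. -/
def IsAhead (t : ℕ) (p : Fin (k + 3)) : Role × Fin (k + 3) → Prop
  | (.left, _) => Even t
  | (.right, _) => Odd t
  | (.middle, j) => if Even t then j < p else p < j

open Classical in
/-- An upper bound for the level of the memory of a node after `r` communication rounds. -/
noncomputable def nodeLevel (r : ℕ) (v : Role × Fin (k + 3)) : ℕ :=
  r / (k + 3) + if IsAhead (r / (k + 3)) (linkNode k r) v then 1 else 0

lemma nodeLevel_le (r : ℕ) (v : Role × Fin (k + 3)) : nodeLevel r v ≤ r / (k + 3) + 1 := by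
  unfold nodeLevel
  split_ifs <;> omega

lemma le_nodeLevel (r : ℕ) (v : Role × Fin (k + 3)) : r / (k + 3) ≤ nodeLevel r v :=
  Nat.le_add_right _ _

lemma isClosedLevel_nodeLevel (r : ℕ) (v : Role × Fin (k + 3)) :
    IsClosedLevel v.1 (nodeLevel r v) := by
  obtain ⟨c, j⟩ := v
  cases c <;> simp only [IsClosedLevel, nodeLevel, IsAhead] <;> grind

lemma IsAhead.of_adj {t : ℕ} {p p' : Fin (k + 3)} {u v : Role × Fin (k + 3)}
    (hp : if Even t then p < p' else p' < p) (huv : u = v ∨ (starGraph p).Adj u v)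
    (hv : IsAhead t p v) : IsAhead t p' u := by
  simp only [starGraph_adj_iff, starPar, starLeaf, Sym2.eq_iff] at huv
  obtain ⟨a, i⟩ := u
  obtain ⟨b, j⟩ := v
  cases a <;> cases b <;> simp only [IsAhead] at hv ⊢ <;> grind

lemma nodeLevel_le_succ (r : ℕ) {u v : Role × Fin (k + 3)}
    (huv : u = v ∨ (starGraph (linkNode k r)).Adj u v) :
    nodeLevel r v ≤ nodeLevel (r + 1) u := by
  rcases succ_div_mod (K := k + 3) (by omega) r with ⟨hdiv, hmod, hlt⟩ | ⟨hdiv, -, -⟩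
  · by_cases hv : IsAhead (r / (k + 3)) (linkNode k r) v
    · have hu : IsAhead ((r + 1) / (k + 3)) (linkNode k (r + 1)) u := by
        rw [hdiv]
        refine hv.of_adj ?_ huv
        simp only [linkNode, hdiv]
        split_ifs <;> simp only [Fin.lt_def, Fin.val_rev, Fin.ofNat, hmod] <;> omega
      simp only [nodeLevel, if_pos hv, if_pos hu, hdiv, le_refl]
    · simp only [nodeLevel, if_neg hv, hdiv]
      omega
  · exact ((nodeLevel_le r v).trans_eq hdiv.symm).trans (le_nodeLevel (r + 1) u)

end Schedule

section Adversary

open Classical in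
lemma exists_eq_count_of_causal {P : (ℕ → ℕ) → ℕ → Prop}
    (hP : ∀ c c' t, (∀ j ≤ t, c j = c' j) → (P c t ↔ P c' t)) :
    ∃ c : ℕ → ℕ, ∀ t, c t = Nat.count (P c) t := by
  let past (t : ℕ) (c : ∀ j < t, ℕ) (j : ℕ) : ℕ := if h : j < t then c j h else 0
  let c (t : ℕ) : ℕ := Nat.strongRec (fun t c => Nat.count (P (past t c)) t) t
  have hc (t : ℕ) : c t = Nat.count (P (past t fun j _ => c j)) t := Nat.strongRec_eq _ t
  have hpast {t s : ℕ} (hs : s < t) : P (past t fun j _ => c j) s ↔ P c s :=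
    hP _ _ _ fun j hj => dif_pos (hj.trans_lt hs)
  exact ⟨c, fun t => (hc t).trans <| le_antisymm
    (Nat.count_mono_left fun _ hs => (hpast hs).1) (Nat.count_mono_left fun _ hs => (hpast hs).2)⟩

namespace FirstOrderMethod

variable (M : FirstOrderMethod) {n : ℕ} {f : Fin n → Ell2 → ℝ} {N : Network n} {t : ℕ}

variable (f) in
lemma exists_network (G : ℕ → SimpleGraph (Fin n)) (W : ℕ → Matrix (Fin n) (Fin n) ℝ) :
    ∃ N : Network n, ∀ t, N.graph t = G (M.commRounds f N t) ∧
      N.gossip t = W (M.commRounds f N t) := by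
  let network (c : ℕ → ℕ) : Network n := ⟨fun t => G (c t), fun t => W (c t)⟩
  obtain ⟨c, hc⟩ := exists_eq_count_of_causal (P := fun c => M.isComm f (network c))
    fun c c' t h => M.nonanticipating f _ _ t fun j hj => by simp only [network, h j hj, and_self]
  exact ⟨network c, fun t => ⟨congrArg G (hc t), congrArg W (hc t)⟩⟩

lemma commRounds_succ_of_isComm (h : M.isComm f N t) :
    M.commRounds f N (t + 1) = M.commRounds f N t + 1 := by
  rw [commRounds, commRounds, Nat.count_succ, if_pos h]

lemma commRounds_succ_of_not_isComm (h : ¬ M.isComm f N t) :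
    M.commRounds f N (t + 1) = M.commRounds f N t := by
  rw [commRounds, commRounds, Nat.count_succ, if_neg h, add_zero]

lemma memory_subset {H : ℕ → Fin n → Submodule ℝ Ell2} (h₀ : ∀ i, M.start ∈ H 0 i)
    (hgrad : ∀ r i, ∀ x ∈ H r i, gradient (f i) x ∈ H r i)
    (hdual : ∀ r i, ∀ x ∈ H r i, gradient (fenchelDual (f i)) x ∈ H r i)
    (hcomm : ∀ t i j, j = i ∨ (N.graph t).Adj i j →
      H (M.commRounds f N t) j ≤ H (M.commRounds f N t + 1) i) (t : ℕ) (i : Fin n) :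
    M.memory f N t i ⊆ H (M.commRounds f N t) i := by
  induction t generalizing i with
  | zero =>
    rw [M.memory_zero, Set.singleton_subset_iff, commRounds, Nat.count_zero]
    exact h₀ i
  | succ t ih =>
    by_cases h : M.isComm f N t
    · refine (M.memory_comm f N t h i).trans (Submodule.span_le.2 ?_)
      rintro z ⟨j, hj, hz⟩
      rw [M.commRounds_succ_of_isComm h]
      exact hcomm t i j hj (ih j hz)
    · refine (M.memory_local f N t h i).trans (Submodule.span_le.2 ?_)
      rw [M.commRounds_succ_of_not_isComm h]
      rintro z ⟨x, hx, rfl | rfl | rfl⟩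
      · exact ih i hx
      · exact hgrad _ i x (ih i hx)
      · exact hdual _ i x (ih i hx)

end FirstOrderMethod

end Adversary

section HardInstance

variable {b : HilbertBasis ℕ ℝ Ell2} {μ κ q : ℝ} {x₀ : Ell2} {c : Role}

lemma isSmooth_chainFunction (hμ : 0 ≤ μ) (hκ : 0 ≤ κ) :
    IsSmooth (μ + 4 * κ) (chainFunction b μ κ q x₀ c) :=
  isSmooth_quadratic (isSymmetric_chainHessian _ _ _ _) _ (norm_chainHessian_le hμ hκ)

lemma isStronglyConvex_chainFunction (hκ : 0 ≤ κ) :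
    IsStronglyConvex μ (chainFunction b μ κ q x₀ c) :=
  isStronglyConvex_quadratic (isSymmetric_chainHessian _ _ _ _) _ (le_inner_chainHessian hκ)

lemma gradient_chainFunction_mem_levelSpace {m : ℕ} (hm : IsClosedLevel c m)
    (h₀ : x₀ ∈ levelSpace b 0) {x : Ell2} (hx : x ∈ levelSpace b m) :
    gradient (chainFunction b μ κ q x₀ c) x ∈ levelSpace b m :=
  gradient_quadratic_mem (isSymmetric_chainHessian _ _ _ _)
    (fun _ => chainHessian_mem_levelSpace hm) (chainShift_mem_levelSpace hm h₀) hx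

lemma gradient_fenchelDual_chainFunction_mem_levelSpace {m : ℕ} (hm : IsClosedLevel c m)
    (h₀ : x₀ ∈ levelSpace b 0) {x : Ell2} (hx : x ∈ levelSpace b m) :
    gradient (fenchelDual (chainFunction b μ κ q x₀ c)) x ∈ levelSpace b m :=
  gradient_fenchelDual_quadratic_mem (isSymmetric_chainHessian _ _ _ _)
    (fun _ => chainHessian_mem_levelSpace hm) (chainShift_mem_levelSpace hm h₀) hx

variable {n k : ℕ} (e : Fin n ≃ Role × Fin (k + 3))

lemma globalFunction_chainFunction_le {z : Ell2} (hμ : 0 ≤ μ) (hκ : 0 ≤ κ)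
    (h₀ : x₀ ∈ levelSpace b 0) (hq : 3 * μ * q = 2 * κ * (1 - q) ^ 2) (hz₀ : inner ℝ (b 0) z = 0)
    (hz : ∀ j, inner ℝ (b (j + 1)) z = q ^ (j + 1)) (y : Ell2) :
    globalFunction (fun i => chainFunction b μ κ q x₀ (e i).1) (x₀ + z) ≤
      globalFunction (fun i => chainFunction b μ κ q x₀ (e i).1) y := by
  refine globalFunction_le_of_sum_gradient_eq_zero hμ
    (fun _ => isStronglyConvex_chainFunction hκ) ?_ y
  rw [e.sum_comp fun v => gradient (chainFunction b μ κ q x₀ v.1) (x₀ + z), Fintype.sum_prod_type,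
    Finset.sum_comm]
  exact Finset.sum_eq_zero fun _ _ => sum_gradient_chainFunction_eq_zero h₀ hq hz₀ hz

namespace FirstOrderMethod

variable {M : FirstOrderMethod} {f : Fin n → Ell2 → ℝ} {N : Network n}

lemma ncard_symmDiff_edgeSet_succ_le
    (hN : ∀ t, N.graph t = (starGraph (linkNode k (M.commRounds f N t))).comap e) (t : ℕ) :
    (symmDiff (N.graph t).edgeSet (N.graph (t + 1)).edgeSet).ncard ≤ 2 := by
  rw [hN, hN]
  refine (ncard_symmDiff_comap_edgeSet_le e.injective _ _).trans ?_
  by_cases h : M.isComm f N t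
  · rw [M.commRounds_succ_of_isComm h]
    exact ncard_symmDiff_edgeSet_le (linkNode_succ k _).1 (linkNode_succ k _).2
  · rw [M.commRounds_succ_of_not_isComm h, symmDiff_self]
    simp

lemma memory_subset_levelSpace (h₀ : M.start ∈ levelSpace b 0)
    (hf : ∀ i, f i = chainFunction b μ κ q M.start (e i).1)
    (hN : ∀ t, N.graph t = (starGraph (linkNode k (M.commRounds f N t))).comap e)
    (t : ℕ) (i : Fin n) :
    M.memory f N t i ⊆ levelSpace b (nodeLevel (M.commRounds f N t) (e i)) := by
  refine M.memory_subset (H := fun r i => levelSpace b (nodeLevel r (e i)))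
    (fun i => levelSpace_mono b (Nat.zero_le _) h₀) (fun r i x hx => ?_) (fun r i x hx => ?_)
    (fun t i j hij => levelSpace_mono b (nodeLevel_le_succ _ ?_)) t i
  · rw [hf]
    exact gradient_chainFunction_mem_levelSpace (isClosedLevel_nodeLevel r (e i)) h₀ hx
  · rw [hf]
    exact gradient_fenchelDual_chainFunction_mem_levelSpace (isClosedLevel_nodeLevel r (e i)) h₀ hx
  · rw [hN] at hij
    exact hij.imp (fun h => congrArg e h.symm) id

end FirstOrderMethod

end HardInstance

section Rates

lemma exists_nat_mul_add_le {a b x : ℝ} (ha : 0 < a) (hx : b ≤ x) :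
    ∃ k : ℕ, a * k + b ≤ x ∧ x < a * (k + 1) + b := by
  have hle := Nat.floor_le (div_nonneg (sub_nonneg.2 hx) ha.le)
  have hlt := Nat.lt_floor_add_one ((x - b) / a)
  rw [le_div_iff₀' ha] at hle
  rw [div_lt_iff₀' ha] at hlt
  exact ⟨_, le_sub_iff_add_le.1 hle, sub_lt_iff_lt_add.1 hlt⟩

lemma sqrt_mul_sqrt_le {μ κ : ℝ} (hμ : 0 < μ) (hκ : 0 < κ) (hμκ : μ ≤ 2 * κ) :
    √(3 * μ / (2 * κ)) * √((μ + 4 * κ) / μ) ≤ 3 := by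
  rw [← Real.sqrt_mul (by positivity)]
  refine Real.sqrt_le_iff.2 ⟨by norm_num, ?_⟩
  rw [show 3 * μ / (2 * κ) * ((μ + 4 * κ) / μ) = 3 * (μ + 4 * κ) / (2 * κ) by field_simp,
    div_le_iff₀ (by positivity)]
  linarith

lemma log_one_div_le_of_pow_le {q ε : ℝ} {m : ℕ} (hq : 0 < q) (h : (q ^ m) ^ 2 ≤ ε) :
    Real.log (1 / ε) ≤ 2 * m * Real.log (1 / q) := by
  have hlog := Real.log_le_log (by positivity) h
  rw [← pow_mul, Real.log_pow] at hlog
  rw [one_div, one_div, Real.log_inv, Real.log_inv]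
  push_cast at hlog
  linarith

lemma le_rounds_of_level_le {χ s l : ℝ} {k r m : ℕ} (hk : χ < 24 * (k + 1) + 56)
    (hsl : 12 ≤ s * l) (hm : s * l ≤ 6 * m) (hr : m ≤ r / (k + 3) + 1) :
    1 / 384 * χ * (s * l) ≤ r := by
  have hlevel : ((k : ℝ) + 3) * (m - 1) ≤ r := by
    have hdiv : ((k : ℝ) + 3) * (r / (k + 3) : ℕ) ≤ r := by exact_mod_cast Nat.mul_div_le r (k + 3)
    have hr' : (m : ℝ) - 1 ≤ (r / (k + 3) : ℕ) := sub_le_iff_le_add.2 (by exact_mod_cast hr)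
    exact (mul_le_mul_of_nonneg_left hr' (by positivity)).trans hdiv
  calc 1 / 384 * χ * (s * l) = χ / 32 * (s * l / 12) := by ring
    _ ≤ (k + 3) * (m - 1) :=
      mul_le_mul (by linarith) (by linarith) (by linarith) (by positivity)
    _ ≤ r := hlevel

lemma le_rounds_of_pow_le {χ μ κ q ε : ℝ} {k r m : ℕ} (hk : χ < 24 * (k + 1) + 56)
    (hμ : 0 < μ) (hμκ : 16 * μ < μ + 4 * κ) (hq : 0 < q)
    (hlog : Real.log (1 / q) ≤ √(3 * μ / (2 * κ))) (hε : 0 < ε) (hε₀ : ε ≤ Real.exp (-3))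
    (hm : (q ^ m) ^ 2 ≤ ε) (hr : m ≤ r / (k + 3) + 1) :
    1 / 384 * χ * √((μ + 4 * κ) / μ) * Real.log (1 / ε) ≤ r := by
  have hs : 4 ≤ √((μ + 4 * κ) / μ) :=
    Real.le_sqrt_of_sq_le ((le_div_iff₀ hμ).2 (by linarith))
  have hl : 3 ≤ Real.log (1 / ε) := by
    rw [one_div, Real.log_inv, le_neg]
    exact (Real.log_le_iff_le_exp hε).2 hε₀
  rw [mul_assoc]
  refine le_rounds_of_level_le hk (by nlinarith) ?_ hr
  calc √((μ + 4 * κ) / μ) * Real.log (1 / ε)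
      ≤ √((μ + 4 * κ) / μ) * (2 * m * √(3 * μ / (2 * κ))) := by
        gcongr
        exact (log_one_div_le_of_pow_le hq hm).trans (by gcongr)
    _ = 2 * m * (√(3 * μ / (2 * κ)) * √((μ + 4 * κ) / μ)) := by ring
    _ ≤ 2 * m * 3 := by
        gcongr
        exact sqrt_mul_sqrt_le hμ (by linarith) (by linarith)
    _ = 6 * m := by ring

end Rates

end Decentralized

theorem mainTheorem5 :
    ∃ c : ℝ, 0 < c ∧ ∃ ε₀ : ℝ, 0 < ε₀ ∧ ε₀ < 1 ∧
      ∀ χ L μ : ℝ, 56 ≤ χ → 0 < μ → 16 * μ < L →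
        ∀ M : Decentralized.FirstOrderMethod,
          ∃ (n : ℕ) (f : Fin n → Decentralized.Ell2 → ℝ) (N : Decentralized.Network n)
            (xstar : Decentralized.Ell2),
            (∀ i, Decentralized.IsSmooth L (f i) ∧ Decentralized.IsStronglyConvex μ (f i)) ∧
            (∀ k, Decentralized.IsGossipMatrix (N.graph k) (N.gossip k) ∧
              (N.gossip k).PosSemidef ∧
              Decentralized.conditionNumber (N.gossip k) = χ) ∧
            (∀ k, (symmDiff (N.graph k).edgeSet (N.graph (k + 1)).edgeSet).ncard ≤ 2) ∧
            (∀ y, Decentralized.globalFunction f xstar ≤ Decentralized.globalFunction f y) ∧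
            ∀ ε : ℝ, 0 < ε → ε ≤ ε₀ →
              ∀ (k : ℕ) (i : Fin n), ∀ x ∈ M.memory f N k i,
                ‖x - xstar‖ ^ 2 ≤ ε * ‖M.start - xstar‖ ^ 2 →
                  c * χ * Real.sqrt (L / μ) * Real.log (1 / ε) ≤ (M.commRounds f N k : ℝ) := by
  open Decentralized FirstOrderMethod in
  refine ⟨1 / 384, by norm_num, Real.exp (-3), Real.exp_pos _, Real.exp_lt_one_iff.2 (by norm_num),
    fun χ L μ hχ hμ hL M => ?_⟩
  obtain ⟨κ, rfl⟩ : ∃ κ, L = μ + 4 * κ := ⟨(L - μ) / 4, by ring⟩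
  have hκ : 0 < κ := by linarith
  obtain ⟨k, hk, hk'⟩ := exists_nat_mul_add_le (a := 24) (by norm_num) hχ
  let e := (Fintype.equivFin (Role × Fin (k + 3))).symm
  choose W hW using exists_starGraph_gossip e hk
  obtain ⟨b, h₀⟩ := exists_hilbertBasis_mem_levelSpace_zero default M.start
  obtain ⟨q, hq₀, hq₁, hq, hlog⟩ := exists_chain_rate (β := 3 * μ / (2 * κ)) (by positivity)
  have hrate : 3 * μ * q = 2 * κ * (1 - q) ^ 2 := by rw [← hq]; field_simp
  obtain ⟨z, hz₀, hz⟩ := exists_geometric_coordinates b hq₀.le hq₁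
  obtain ⟨N, hN⟩ := M.exists_network (fun i => chainFunction b μ κ q M.start (e i).1)
    (fun r => (starGraph (linkNode k r)).comap e) (fun r => W (linkNode k r))
  have hgraph t := (hN t).1
  refine ⟨_, _, N, M.start + z,
    fun i => ⟨isSmooth_chainFunction hμ.le hκ.le, isStronglyConvex_chainFunction hκ.le⟩,
    fun t => ?_, ncard_symmDiff_edgeSet_succ_le e hgraph,
    globalFunction_chainFunction_le e hμ.le hκ.le h₀ hrate hz₀ hz,
    fun ε hε hε₀ t i x hx hxε => ?_⟩
  · rw [(hN t).1, (hN t).2]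
    exact hW _
  · have hmem := memory_subset_levelSpace e h₀ (fun _ => rfl) hgraph t i hx
    have hpow := pow_sq_le_of_norm_sub_sq_le hq₀ h₀ hz₀ hz hmem hxε
    exact le_rounds_of_pow_le hk' hμ hL hq₀ hlog hε hε₀ hpow (nodeLevel_le _ (e i))
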